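/- Let $\mathcal H$ be a complex Hilbert space and let $T,T'$ be contractions on $\mathcal H$, i.e. bounded linear operators with $\|T\|\le 1$, $\|T'\|\le 1$. For a bounded operator $A$ write $\Re A=\tfrac12(A+A^*)$, $\mathcal N(A)$ for its kernel and $\mathcal R(A)$ for its range. One says that $T$ is Harnack dominated by $T'$ if there is a constant $c\ge 1$ such that $\Re p(T)\le c\,\Re p(T')$ for every polynomial $p\in\mathbb C[z]$ with $\Re p(z)\ge 0$ for all $|z|\le 1$ (the same definition is used for contractions on any other complex Hilbert space). Theorem. Suppose that $T$ is Harnack dominated by $T'$. Then: (i) $\mathcal N(I-T)=\mathcal N(I-T')$ and $\overline{\mathcal R(T-T')}\subset\overline{\mathcal R(I-T)}=\overline{\mathcal R(I-T')}$. (ii) $\mathcal H=\mathcal N(I-T)\oplus\overline{\mathcal R(I-T)}$ is an orthogonal decomposition, and with respect to it $T=I\oplus T_1$ and $T'=I\oplus T_1'$, where $T_1,T_1'$ are contractions on $\overline{\mathcal R(I-T)}$ and $T_1$ is Harnack dominated by $T_1'$. (iii) For every complex sequence $(\alpha_n)_{n\ge 0}$ with $\sum_{n}|\alpha_n|^2<\infty$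 and every $h\in\mathcal H$, the series $\sum_{n=0}^\infty \alpha_n T^n(T-T')h$ converges in the norm of $\mathcal H$. -/

import Mathlib

open Polynomial Filter Topology

/-- Harnack domination of bounded operators on a complex Hilbert space (used for contractions):
there is a constant `c ≥ 1` such that `Re p(T) ≤ c Re p(T')` in the order of self-adjoint operators
for every analytic polynomial `p` with `Re p ≥ 0` on the closed unit disc.
Here `Re A = (A + A*) / 2`. -/
def HarnackDominated {H : Type*} [NormedAddCommGroup H] [InnerProductSpace ℂ H] [CompleteSpace H]
    (T T' : H →L[ℂ] H) : Prop :=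
  ∃ c : ℝ, 1 ≤ c ∧ ∀ p : ℂ[X], (∀ z : ℂ, ‖z‖ ≤ 1 → 0 ≤ (p.eval z).re) →
    (realPart (aeval T p) : H →L[ℂ] H) ≤ c • (realPart (aeval T' p) : H →L[ℂ] H)

/-- The kernel `N(A)` of a bounded operator. -/
def opKer {H : Type*} [NormedAddCommGroup H] [InnerProductSpace ℂ H] (A : H →L[ℂ] H) :
    Submodule ℂ H :=
  LinearMap.ker (A : H →ₗ[ℂ] H)

/-- The closure of the range `R(A)` of a bounded operator. -/
def opClosureRange {H : Type*} [NormedAddCommGroup H] [InnerProductSpace ℂ H] (A : H →L[ℂ] H) :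
    Submodule ℂ H :=
  (LinearMap.range (A : H →ₗ[ℂ] H)).topologicalClosure

instance opClosureRange.completeSpace {H : Type*} [NormedAddCommGroup H] [InnerProductSpace ℂ H]
    [CompleteSpace H] (A : H →L[ℂ] H) : CompleteSpace (opClosureRange A) :=
  inferInstanceAs (CompleteSpace (LinearMap.range (A : H →ₗ[ℂ] H)).topologicalClosure)

/-- `H` is the orthogonal direct sum of the subspaces `M` and `N`. -/
def IsOrthogonalDecomposition {H : Type*} [NormedAddCommGroup H] [InnerProductSpace ℂ H]
    (M N : Submodule ℂ H) : Prop :=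
  M ⟂ N ∧ M ⊔ N = ⊤

/-- `T = A ⊕ B` with respect to the decomposition `H = M ⊕ N`. -/
def IsDirectSumOp {H : Type*} [NormedAddCommGroup H] [InnerProductSpace ℂ H]
    {M N : Submodule ℂ H} (T : H →L[ℂ] H) (A : M →L[ℂ] M) (B : N →L[ℂ] N) : Prop :=
  ∀ (x : M) (y : N), T ((x : H) + (y : H)) = (A x : H) + (B y : H)

/-! Everything rests on one estimate: ‖∑ αₙTⁿ(T-T')x‖² ≤ c ∑|αₙ|² ‖x‖². Testing domination on
rotated Fejér polynomials and vectors ∑ wⁱhᵢ, then averaging over roots of unity `w`, compares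
Toeplitz forms of `T` and `T'`. In the limit these become ‖∑ Vʲhⱼ‖², `V` an isometric dilation,
without constructing `V`. The form of `T` dominates ‖∑ Tʲhⱼ‖². For hⱼ = βⱼx - βⱼ₊₁T'x this sum
telescopes to powers of `T` applied to (T-T')x, while the form of `T'` is at most ∑|βⱼ|²‖x‖².

The estimate gives (iii) by the Cauchy criterion. Taking αₙ = 1 against a fixed vector of `T` shows
that this vector is orthogonal to R(T-T'), which yields the range inclusion and one kernel
inclusion; the polynomial 1 - z yields the other. Since a contraction and its adjoint have the same
fixed vectors, the rest of (i) and (ii) follows. -/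

theorem realPart_le_smul_realPart_iff {H : Type*} [NormedAddCommGroup H] [InnerProductSpace ℂ H]
    [CompleteSpace H] (A B : H →L[ℂ] H) (c : ℝ) :
    (realPart A : H →L[ℂ] H) ≤ c • (realPart B : H →L[ℂ] H) ↔
      ∀ x : H, (inner ℂ x (A x)).re ≤ c * (inner ℂ x (B x)).re := by
  have key (A : H →L[ℂ] H) (x : H) :
      (inner ℂ x ((realPart A : H →L[ℂ] H) x)).re = (inner ℂ x (A x)).re := by
    rw [realPart_apply_coe]
    have h1 : (inner ℂ x ((star A) x)).re = (inner ℂ x (A x)).re := by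
      rw [ContinuousLinearMap.star_eq_adjoint, ContinuousLinearMap.adjoint_inner_right,
        ← inner_conj_symm, Complex.conj_re]
    rw [smul_apply, add_apply,
      ← Complex.coe_smul, inner_smul_right, inner_add_right, Complex.re_ofReal_mul,
      Complex.add_re, h1]
    ring
  rw [ContinuousLinearMap.le_def, ContinuousLinearMap.isPositive_iff_complex]
  refine forall_congr' fun x => ?_
  have hsa : IsSelfAdjoint (c • (realPart B : H →L[ℂ] H) - (realPart A : H →L[ℂ] H)) := by
    apply IsSelfAdjoint.sub
    · exact IsSelfAdjoint.smul (by simp [IsSelfAdjoint]) (realPart B).2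
    · exact (realPart A).2
  have hre : (inner ℂ ((c • (realPart B : H →L[ℂ] H) - (realPart A : H →L[ℂ] H)) x) x).re
      = c * (inner ℂ x (B x)).re - (inner ℂ x (A x)).re := by
    rw [← inner_conj_symm, Complex.conj_re, sub_apply,
      smul_apply, ← Complex.coe_smul, inner_sub_right, inner_smul_right,
      Complex.sub_re, Complex.re_ofReal_mul, key, key]
  constructor
  · rintro ⟨-, h⟩
    change 0 ≤ Complex.re _ at h
    rw [hre] at h
    linarith
  · intro h
    refine ⟨?_, ?_⟩
    · exact hsa.isSymmetric.coe_re_inner_apply_self x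
    · change 0 ≤ Complex.re _
      rw [hre]
      linarith

/-! ### Fejér polynomials and averages over roots of unity -/

/-- The coefficients of the (unnormalised) analytic Fejér kernel of order `N`. -/
noncomputable def fejerCoeff (N n : ℕ) : ℝ := if n = 0 then N else 2 * ((N : ℝ) - n)

/-- In the expansion of |∑ zⁿ|², exactly N - n pairs of exponents have each difference ±n. -/
theorem fejer_sum_re_eq_normSq {z : ℂ} (hz : ‖z‖ = 1) (N : ℕ) :
    (∑ n ∈ Finset.range N, (fejerCoeff N n : ℂ) * z ^ n).re
      = Complex.normSq (∑ n ∈ Finset.range N, z ^ n) := by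
  induction N with
  | zero => simp
  | succ N ih =>
    have hz1 : Complex.normSq (z ^ N) = 1 := by
      rw [Complex.normSq_eq_norm_sq, norm_pow, hz]; simp
    have hzz : z * (starRingEnd ℂ) z = 1 := by
      rw [Complex.mul_conj, Complex.normSq_eq_norm_sq, hz]; simp
    rw [Finset.sum_range_succ (fun n => z ^ n), Complex.normSq_add, ← ih, hz1]
    have h1 : ∀ N : ℕ, (∑ n ∈ Finset.range N, z ^ n) * (starRingEnd ℂ) (z ^ N)
        = (starRingEnd ℂ) (∑ n ∈ Finset.range N, z ^ (n + 1)) := by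
      intro N
      induction N with
      | zero => simp
      | succ N ih =>
        rw [Finset.sum_range_succ', Finset.sum_range_succ, map_add, ← ih, pow_zero, add_mul,
          one_mul]
        congr 1
        simp only [pow_succ, map_mul, map_pow]
        rw [← Finset.sum_mul]
        linear_combination (∑ n ∈ Finset.range N, z ^ n) * (starRingEnd ℂ) z ^ N * hzz
    rw [h1, Complex.conj_re]
    have h2 : ∑ n ∈ Finset.range (N + 1), (fejerCoeff (N + 1) n : ℂ) * z ^ n
        = ∑ n ∈ Finset.range N, (fejerCoeff N n : ℂ) * z ^ n + 1
          + 2 * ∑ n ∈ Finset.range N, z ^ (n + 1) := by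
      have h3 : ∑ n ∈ Finset.range N, (fejerCoeff N n : ℂ) * z ^ n
          = ∑ n ∈ Finset.range (N + 1), (fejerCoeff N n : ℂ) * z ^ n := by
        rw [Finset.sum_range_succ]
        by_cases h : N = 0 <;> simp [fejerCoeff, h]
      rw [h3, Finset.sum_range_succ', Finset.sum_range_succ' _ N, Finset.mul_sum]
      have h4 : ∀ n, (fejerCoeff (N + 1) (n + 1) : ℂ) * z ^ (n + 1)
          = (fejerCoeff N (n + 1) : ℂ) * z ^ (n + 1) + 2 * z ^ (n + 1) := by
        intro n
        simp only [fejerCoeff, Nat.succ_ne_zero, if_false]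
        push_cast
        ring
      simp only [h4, Finset.sum_add_distrib]
      simp [fejerCoeff]
      ring
    rw [h2]
    simp

theorem re_nonneg_of_forall_norm_eq_one (p : ℂ[X])
    (hp : ∀ z : ℂ, ‖z‖ = 1 → 0 ≤ (p.eval z).re) {z : ℂ} (hz : ‖z‖ ≤ 1) :
    0 ≤ (p.eval z).re := by
  -- The maximum modulus principle for exp(-p), whose modulus is exp(-Re p).
  have hd : Differentiable ℂ fun z : ℂ => Complex.exp (-p.eval z) :=
    p.differentiable.neg.cexp
  have := Complex.norm_le_of_forall_mem_frontier_norm_le (U := Metric.ball (0 : ℂ) 1) (C := 1)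
    (f := fun z : ℂ => Complex.exp (-p.eval z)) Metric.isBounded_ball hd.diffContOnCl
    (fun w hw => by
      rw [frontier_ball _ one_ne_zero] at hw
      rw [Complex.norm_exp, Real.exp_le_one_iff, Complex.neg_re]
      have := hp w (by simpa using hw)
      linarith)
    (z := z) (by rw [closure_ball _ one_ne_zero]; simpa using hz)
  rw [Complex.norm_exp, Real.exp_le_one_iff, Complex.neg_re] at this
  linarith

/-- The analytic Fejér polynomial of order `N`, rotated by `u`. -/
noncomputable def fejerPoly (N : ℕ) (u : ℂ) : ℂ[X] :=
  ∑ n ∈ Finset.range N, C ((fejerCoeff N n : ℂ) * u ^ n) * X ^ n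

theorem fejerPoly_re_nonneg (N : ℕ) {u z : ℂ} (hu : ‖u‖ = 1) (hz : ‖z‖ ≤ 1) :
    0 ≤ ((fejerPoly N u).eval z).re := by
  refine re_nonneg_of_forall_norm_eq_one _ (fun z hz => ?_) hz
  have h : (fejerPoly N u).eval z
      = ∑ n ∈ Finset.range N, (fejerCoeff N n : ℂ) * (u * z) ^ n := by
    simp [fejerPoly, eval_finsetSum, mul_pow, mul_assoc]
  rw [h, fejer_sum_re_eq_normSq (by simp [hu, hz])]
  exact Complex.normSq_nonneg _

theorem sum_range_zpow_primitiveRoot {M : ℕ} {ζ : ℂ} (hζ : IsPrimitiveRoot ζ M) {e : ℤ}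
    (he : |e| < M) :
    ∑ k ∈ Finset.range M, (ζ ^ k) ^ e = if e = 0 then (M : ℂ) else 0 := by
  have hM : 0 < M := by
    have := (abs_nonneg e).trans_lt he
    exact_mod_cast this
  split_ifs with h
  · simp [h]
  · have h1 : ∀ k : ℕ, (ζ ^ k) ^ e = (ζ ^ e) ^ k := fun k => by
      rw [← zpow_natCast, ← zpow_natCast, ← zpow_mul, ← zpow_mul, mul_comm]
    simp only [h1]
    have hne : ζ ^ e ≠ 1 := by
      rw [Ne, hζ.zpow_eq_one_iff_dvd]
      intro hd
      exact h (Int.eq_zero_of_abs_lt_dvd hd he)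
    rw [geom_sum_eq hne, ← h1, hζ.pow_eq_one]
    simp

/-! ### Toeplitz forms and the square-sum estimate -/

section Toeplitz

variable {H : Type*} [NormedAddCommGroup H] [InnerProductSpace ℂ H]

/-- Upper triangular Toeplitz form with weights `a` of the powers of `T`. -/
noncomputable def toeplitzForm (a : ℕ → ℝ) (T : H →L[ℂ] H) (h : ℕ → H) (m : ℕ) : ℝ :=
  ∑ i ∈ Finset.range m, ∑ j ∈ Finset.range m,
    if i ≤ j then a (j - i) * (inner ℂ (h i) ((T ^ (j - i)) (h j))).re else 0

/-- On the unit circle conjugation is inversion, so all phases merge into one integer power of `w`;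
averaging then keeps only n = j - i. -/
theorem inner_fejerPoly (T : H →L[ℂ] H) (h : ℕ → H) (m N : ℕ) {w : ℂ} (hw : ‖w‖ = 1) :
    inner ℂ (∑ i ∈ Finset.range m, w ^ i • h i)
      (aeval T (fejerPoly N w⁻¹) (∑ j ∈ Finset.range m, w ^ j • h j))
    = ∑ i ∈ Finset.range m, ∑ j ∈ Finset.range m, ∑ n ∈ Finset.range N,
        w ^ ((j : ℤ) - i - n) * (fejerCoeff N n * inner ℂ (h i) ((T ^ n) (h j))) := by
  have hw0 : w ≠ 0 := by rintro rfl; simp at hw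
  have hc : (starRingEnd ℂ) w = w⁻¹ := by
    rw [Complex.inv_def, Complex.normSq_eq_norm_sq, hw]; simp
  rw [sum_inner]
  refine Finset.sum_congr rfl fun i _ => ?_
  rw [map_sum, inner_sum]
  refine Finset.sum_congr rfl fun j _ => ?_
  simp only [fejerPoly, map_sum, map_mul, aeval_C, map_pow, aeval_X]
  rw [sum_apply, inner_sum]
  refine Finset.sum_congr rfl fun n _ => ?_
  rw [← map_pow, ← map_mul, mul_apply_eq_comp,
    ContinuousLinearMap.algebraMap_apply, map_smul, inner_smul_left, inner_smul_right,
    inner_smul_right, map_pow, hc, zpow_sub₀ hw0, zpow_sub₀ hw0]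
  simp only [zpow_natCast, inv_pow]
  field_simp

theorem sum_inner_fejerPoly_re (T : H →L[ℂ] H) (h : ℕ → H) {m N : ℕ} (hmN : m ≤ N) {ζ : ℂ}
    (hζ : IsPrimitiveRoot ζ (N + m)) (hζ1 : ‖ζ‖ = 1) :
    ∑ k ∈ Finset.range (N + m), (inner ℂ (∑ i ∈ Finset.range m, (ζ ^ k) ^ i • h i)
      (aeval T (fejerPoly N (ζ ^ k)⁻¹) (∑ j ∈ Finset.range m, (ζ ^ k) ^ j • h j))).re
    = (N + m : ℕ) * toeplitzForm (fejerCoeff N) T h m := by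
  have h1 : ∀ k, ‖ζ ^ k‖ = 1 := fun k => by simp [hζ1]
  simp only [inner_fejerPoly T h m N (h1 _)]
  rw [← Complex.re_sum, Finset.sum_comm]
  rw [toeplitzForm, Finset.mul_sum, Complex.re_sum]
  refine Finset.sum_congr rfl fun i hi => ?_
  rw [Finset.sum_comm, Finset.mul_sum, Complex.re_sum]
  refine Finset.sum_congr rfl fun j hj => ?_
  rw [Finset.sum_comm]
  rw [Finset.mem_range] at hi hj
  have h2 : ∀ n ∈ Finset.range N, ∑ k ∈ Finset.range (N + m), (ζ ^ k) ^ ((j : ℤ) - i - n)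
        * (fejerCoeff N n * inner ℂ (h i) ((T ^ n) (h j)))
      = if (j : ℤ) - i - n = 0 then
        ((N + m : ℕ) : ℂ) * (fejerCoeff N n * inner ℂ (h i) ((T ^ n) (h j))) else 0 := by
    intro n hn
    rw [Finset.mem_range] at hn
    -- Since |j - i - n| < N + m, roots of this order produce no aliasing.
    rw [← Finset.sum_mul, sum_range_zpow_primitiveRoot hζ (by rw [abs_lt]; push_cast; omega)]
    split_ifs <;> simp
  rw [Finset.sum_congr rfl h2]
  split_ifs with hij
  · rw [Finset.sum_eq_single (j - i)]
    · rw [if_pos (by omega), ← Complex.ofReal_natCast, Complex.re_ofReal_mul,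
        Complex.re_ofReal_mul]
    · intro n _ hn
      rw [if_neg (by omega)]
    · intro hn
      exact absurd (Finset.mem_range.2 (by omega)) hn
  · rw [Finset.sum_eq_zero fun n _ => if_neg (by omega)]
    simp

/-- The weights `1, 2, 2, …` for which the Toeplitz form is the squared norm of
`∑ Vʲ hⱼ`, where `V` is an isometric dilation of `T`. -/
noncomputable def dilationWeight (n : ℕ) : ℝ := if n = 0 then 1 else 2

theorem tendsto_toeplitzForm_fejerCoeff (T : H →L[ℂ] H) (h : ℕ → H) (m : ℕ) :
    Tendsto (fun N : ℕ => (N : ℝ)⁻¹ * toeplitzForm (fejerCoeff N) T h m) atTop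
      (𝓝 (toeplitzForm dilationWeight T h m)) := by
  have hcoef : ∀ n : ℕ, Tendsto (fun N : ℕ => (N : ℝ)⁻¹ * fejerCoeff N n) atTop
      (𝓝 (dilationWeight n)) := by
    intro n
    by_cases hn : n = 0
    · refine tendsto_const_nhds.congr' ?_
      filter_upwards [eventually_gt_atTop 0] with N hN
      have : (N : ℝ) ≠ 0 := by positivity
      simp [hn, dilationWeight, fejerCoeff, this]
    · have h0 : Tendsto (fun N : ℕ => 2 - 2 * n * (N : ℝ)⁻¹) atTop (𝓝 (2 - 2 * n * 0)) :=
        (tendsto_inv_atTop_nhds_zero_nat.const_mul (2 * n : ℝ)).const_sub 2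
      rw [mul_zero, sub_zero] at h0
      rw [dilationWeight, if_neg hn]
      refine h0.congr' ?_
      filter_upwards [eventually_gt_atTop 0] with N hN
      have : (N : ℝ) ≠ 0 := by positivity
      rw [fejerCoeff, if_neg hn]
      field_simp
  simp only [toeplitzForm, Finset.mul_sum]
  refine tendsto_finsetSum _ fun i _ => tendsto_finsetSum _ fun j _ => ?_
  split_ifs
  · simp only [← mul_assoc]
    exact (hcoef _).mul_const _
  · simp

theorem toeplitzForm_succ (T : H →L[ℂ] H) (h : ℕ → H) (m : ℕ) :
    toeplitzForm dilationWeight T h (m + 1) = ‖h 0‖ ^ 2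
      + 2 * (inner ℂ (h 0) (T (∑ j ∈ Finset.range m, (T ^ j) (h (j + 1))))).re
      + toeplitzForm dilationWeight T (fun j => h (j + 1)) m := by
  rw [toeplitzForm, Finset.sum_range_succ', add_comm, Finset.sum_range_succ']
  congr 1
  · simp only [map_sum, inner_sum, Complex.re_sum, Finset.mul_sum, dilationWeight]
    simp [pow_succ', add_comm]
  · simp only [toeplitzForm]
    refine Finset.sum_congr rfl fun i _ => ?_
    rw [Finset.sum_range_succ']
    simp

/-- Horner's scheme: write the sum as h₀ + Ts, expand the square and use ‖Ts‖ ≤ ‖s‖. -/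
theorem norm_sum_pow_sq_le_toeplitzForm {T : H →L[ℂ] H} (hT : ‖T‖ ≤ 1) (h : ℕ → H) (m : ℕ) :
    ‖∑ j ∈ Finset.range m, (T ^ j) (h j)‖ ^ 2 ≤ toeplitzForm dilationWeight T h m := by
  induction m generalizing h with
  | zero => simp [toeplitzForm]
  | succ m ih =>
    have h1 : ∑ j ∈ Finset.range (m + 1), (T ^ j) (h j)
        = h 0 + T (∑ j ∈ Finset.range m, (T ^ j) (h (j + 1))) := by
      rw [Finset.sum_range_succ', add_comm, map_sum]
      simp [pow_succ']
    rw [h1, toeplitzForm_succ]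
    have h2 := norm_add_sq (𝕜 := ℂ) (h 0) (T (∑ j ∈ Finset.range m, (T ^ j) (h (j + 1))))
    rw [h2]
    have h3 : ‖T (∑ j ∈ Finset.range m, (T ^ j) (h (j + 1)))‖ ^ 2
        ≤ ‖∑ j ∈ Finset.range m, (T ^ j) (h (j + 1))‖ ^ 2 :=
      pow_le_pow_left₀ (norm_nonneg _) ((T.le_of_opNorm_le hT _).trans_eq (one_mul _)) 2
    have h4 := ih fun j => h (j + 1)
    change _ + 2 * Complex.re _ + _ ≤ _
    linarith

theorem sum_pow_telescope (T S : H →L[ℂ] H) (x : H) (β : ℕ → ℂ) (m : ℕ) :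
    ∑ j ∈ Finset.range m, (T ^ j) (β j • x - β (j + 1) • S x)
      = β 0 • x - β m • (T ^ m) x
        + ∑ j ∈ Finset.range m, β (j + 1) • (T ^ j) ((T - S) x) := by
  induction m with
  | zero => simp
  | succ m ih =>
    rw [Finset.sum_range_succ, ih, Finset.sum_range_succ]
    simp only [map_sub, map_smul, sub_apply, pow_succ,
      mul_apply_eq_comp, smul_sub]
    abel

theorem toeplitzForm_telescope_le (S : H →L[ℂ] H) (x : H) (β : ℕ → ℂ) (m : ℕ)
    (hβ : β m = 0) :
    toeplitzForm dilationWeight S (fun j => β j • x - β (j + 1) • S x) m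
      ≤ (∑ j ∈ Finset.range m, ‖β j‖ ^ 2) * ‖x‖ ^ 2 := by
  induction m generalizing β with
  | zero => simp [toeplitzForm]
  | succ m ih =>
    have h1 := ih (fun j => β (j + 1)) hβ
    rw [toeplitzForm_succ, sum_pow_telescope S S x (fun j => β (j + 1)) m, Finset.sum_range_succ']
    simp only [hβ, sub_self, zero_apply, map_zero, smul_zero,
      Finset.sum_const_zero, zero_smul, sub_zero, add_zero, zero_add]
    -- The tail telescopes to β₁x, so the new terms equal ‖β₀x‖² - ‖β₁Sx‖².
    have h2 := norm_add_sq (𝕜 := ℂ) (β 0 • x - β 1 • S x) (S (β 1 • x))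
    rw [map_smul, sub_add_cancel, norm_smul, mul_pow] at h2
    change _ = _ + 2 * Complex.re _ + _ at h2
    rw [map_smul]
    have h3 := sq_nonneg ‖β 1 • S x‖
    linarith

variable [CompleteSpace H]

theorem HarnackDominated.exists_toeplitzForm_le {T T' : H →L[ℂ] H}
    (hdom : HarnackDominated T T') :
    ∃ c : ℝ, 0 ≤ c ∧ ∀ (h : ℕ → H) (m : ℕ),
      toeplitzForm dilationWeight T h m ≤ c * toeplitzForm dilationWeight T' h m := by
  obtain ⟨c, hc, hp⟩ := hdom
  refine ⟨c, by linarith, fun h m => ?_⟩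
  refine le_of_tendsto_of_tendsto (tendsto_toeplitzForm_fejerCoeff T h m)
    ((tendsto_toeplitzForm_fejerCoeff T' h m).const_mul c) ?_
  filter_upwards [eventually_ge_atTop m, eventually_gt_atTop 0] with N hmN hN
  have hζ := Complex.isPrimitiveRoot_exp (N + m) (by omega)
  have hζ1 : ‖_‖ = (1 : ℝ) := hζ.norm'_eq_one (by omega)
  set ζ := Complex.exp (2 * Real.pi * Complex.I / (N + m : ℕ))
  have hsum := Finset.sum_le_sum fun k (_ : k ∈ Finset.range (N + m)) =>
    (realPart_le_smul_realPart_iff _ _ _).1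
      (hp (fejerPoly N (ζ ^ k)⁻¹) fun z hz => fejerPoly_re_nonneg N (by simp [hζ1]) hz)
      (∑ i ∈ Finset.range m, (ζ ^ k) ^ i • h i)
  rw [← Finset.mul_sum, sum_inner_fejerPoly_re T h hmN hζ hζ1,
    sum_inner_fejerPoly_re T' h hmN hζ hζ1, mul_left_comm] at hsum
  have hpos : (0 : ℝ) < (N + m : ℕ) := by exact_mod_cast (by omega : 0 < N + m)
  rw [mul_left_comm]
  exact mul_le_mul_of_nonneg_left (le_of_mul_le_mul_left hsum hpos) (by positivity)

theorem HarnackDominated.exists_norm_sum_sq_le {T T' : H →L[ℂ] H}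
    (hdom : HarnackDominated T T') (hT : ‖T‖ ≤ 1) :
    ∃ c : ℝ, 0 ≤ c ∧ ∀ (α : ℕ → ℂ) (m : ℕ) (x : H),
      ‖∑ n ∈ Finset.range m, α n • (T ^ n) ((T - T') x)‖ ^ 2
        ≤ c * ((∑ n ∈ Finset.range m, ‖α n‖ ^ 2) * ‖x‖ ^ 2) := by
  obtain ⟨c, hc, hle⟩ := hdom.exists_toeplitzForm_le
  refine ⟨c, hc, fun α m x => ?_⟩
  -- The shift of `α`, zero at 0 and m + 1, so that both boundary terms of the telescoped sum
  -- vanish.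
  let β : ℕ → ℂ := fun n => if n = 0 then 0 else if n ≤ m then α (n - 1) else 0
  have hβ : ∀ n ∈ Finset.range m, β (n + 1) = α n := fun n hn => by
    rw [Finset.mem_range] at hn
    simp [β, Nat.succ_le_of_lt hn]
  have hβ0 : β 0 = 0 := by simp [β]
  have hβm : β (m + 1) = 0 := by simp [β]
  have h1 := sum_pow_telescope T T' x β (m + 1)
  rw [hβ0, hβm, Finset.sum_range_succ (fun j => β (j + 1) • (T ^ j) ((T - T') x)), hβm,
    zero_smul, zero_smul, zero_smul, sub_zero, zero_add, add_zero] at h1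
  have h2 : ∑ n ∈ Finset.range m, α n • (T ^ n) ((T - T') x)
      = ∑ n ∈ Finset.range m, β (n + 1) • (T ^ n) ((T - T') x) :=
    Finset.sum_congr rfl fun n hn => by rw [hβ n hn]
  rw [h2, ← h1]
  refine (norm_sum_pow_sq_le_toeplitzForm hT _ _).trans ((hle _ _).trans ?_)
  refine mul_le_mul_of_nonneg_left ?_ hc
  refine (toeplitzForm_telescope_le T' x β (m + 1) hβm).trans_eq ?_
  rw [Finset.sum_range_succ', hβ0, Finset.sum_congr rfl fun n hn => by rw [hβ n hn]]
  simp

end Toeplitz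

/-! ### Fixed vectors, reduction and convergence -/

section Contraction

variable {H : Type*} [NormedAddCommGroup H] [InnerProductSpace ℂ H]

theorem mem_opKer_one_sub {T : H →L[ℂ] H} {x : H} : x ∈ opKer (1 - T) ↔ T x = x := by
  rw [opKer, LinearMap.mem_ker]
  change x - T x = 0 ↔ _
  rw [sub_eq_zero, eq_comm]

/-- The equality case of Cauchy–Schwarz: expanding ‖x - Ax‖² gives at most 0. -/
theorem apply_eq_self_of_norm_sq_le_re_inner {A : H →L[ℂ] H} (hA : ‖A‖ ≤ 1) {x : H}
    (hx : ‖x‖ ^ 2 ≤ (inner ℂ x (A x)).re) : A x = x := by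
  have h1 := norm_sub_sq (𝕜 := ℂ) x (A x)
  change _ = _ - 2 * Complex.re _ + _ at h1
  have h2 : ‖A x‖ ^ 2 ≤ ‖x‖ ^ 2 :=
    pow_le_pow_left₀ (norm_nonneg _) ((A.le_of_opNorm_le hA x).trans_eq (one_mul _)) 2
  have h3 : ‖x - A x‖ ^ 2 = 0 := le_antisymm (by linarith) (sq_nonneg _)
  rw [sq_eq_zero_iff, norm_eq_zero, sub_eq_zero] at h3
  exact h3.symm

theorem norm_restrict_le_one {T : H →L[ℂ] H} (hT : ‖T‖ ≤ 1) {M : Submodule ℂ H}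
    (hM : Set.MapsTo T M M) : ‖T.restrict hM‖ ≤ 1 :=
  ContinuousLinearMap.opNorm_le_bound _ zero_le_one fun x => T.le_of_opNorm_le hT x

theorem isDirectSumOp_one_restrict {T : H →L[ℂ] H} {M : Submodule ℂ H}
    (hM : Set.MapsTo T M M) :
    IsDirectSumOp T (1 : opKer (1 - T) →L[ℂ] opKer (1 - T)) (T.restrict hM) := by
  intro x y
  rw [map_add, mem_opKer_one_sub.1 x.2]
  rfl

theorem coe_aeval_restrict {T : H →L[ℂ] H} {M : Submodule ℂ H} (hM : Set.MapsTo T M M)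
    (p : ℂ[X]) (x : M) : ((aeval (T.restrict hM) p) x : H) = (aeval T p) x := by
  have hpow : ∀ n : ℕ, (((T.restrict hM) ^ n) x : H) = (T ^ n) x := fun n => by
    induction n with
    | zero => rfl
    | succ n ih =>
      rw [pow_succ', pow_succ', mul_apply_eq_comp, mul_apply_eq_comp, ← ih]
      rfl
  induction p using Polynomial.induction_on' with
  | add p q hp hq => simp [hp, hq]
  | monomial n a =>
    rw [aeval_monomial, aeval_monomial, mul_apply_eq_comp, mul_apply_eq_comp,
      ContinuousLinearMap.algebraMap_apply, ContinuousLinearMap.algebraMap_apply,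
      Submodule.coe_smul, hpow]

variable [CompleteSpace H]

theorem adjoint_apply_eq_self_of_apply_eq_self {T : H →L[ℂ] H} (hT : ‖T‖ ≤ 1) {x : H}
    (hx : T x = x) : ContinuousLinearMap.adjoint T x = x := by
  refine apply_eq_self_of_norm_sq_le_re_inner (by simpa using hT) ?_
  rw [ContinuousLinearMap.adjoint_inner_right, hx]
  exact (inner_self_eq_norm_sq (𝕜 := ℂ) x).ge

theorem opClosureRange_one_sub_eq {T : H →L[ℂ] H} (hT : ‖T‖ ≤ 1) :
    opClosureRange (1 - T) = (opKer (1 - T))ᗮ := by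
  have h : opKer (1 - T) = (LinearMap.range ((1 - T : H →L[ℂ] H) : H →ₗ[ℂ] H))ᗮ := by
    ext x
    rw [mem_opKer_one_sub]
    constructor
    · intro hx
      rw [Submodule.mem_orthogonal]
      rintro _ ⟨y, rfl⟩
      change inner ℂ (y - T y) x = 0
      rw [inner_sub_left, ← ContinuousLinearMap.adjoint_inner_right,
        adjoint_apply_eq_self_of_apply_eq_self hT hx, sub_self]
    · intro hx
      refine apply_eq_self_of_norm_sq_le_re_inner hT ?_
      have h1 : inner ℂ (x - T x) x = 0 := (Submodule.mem_orthogonal _ _).1 hx _ ⟨x, rfl⟩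
      rw [← inner_conj_symm, map_eq_zero, inner_sub_right, sub_eq_zero] at h1
      rw [← h1]
      exact (inner_self_eq_norm_sq (𝕜 := ℂ) x).ge
  rw [h, Submodule.orthogonal_orthogonal_eq_closure, opClosureRange]

theorem isOrthogonalDecomposition_opKer_opClosureRange {T : H →L[ℂ] H} (hT : ‖T‖ ≤ 1) :
    IsOrthogonalDecomposition (opKer (1 - T)) (opClosureRange (1 - T)) := by
  have : CompleteSpace (opKer (1 - T)) :=
    (ContinuousLinearMap.isClosed_ker (1 - T)).completeSpace_coe
  rw [opClosureRange_one_sub_eq hT]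
  exact ⟨Submodule.isOrtho_orthogonal_right _, Submodule.sup_orthogonal_of_hasOrthogonalProjection⟩

theorem apply_mem_opClosureRange_one_sub {T : H →L[ℂ] H} (hT : ‖T‖ ≤ 1) {x : H}
    (hx : x ∈ opClosureRange (1 - T)) : T x ∈ opClosureRange (1 - T) := by
  rw [opClosureRange_one_sub_eq hT, Submodule.mem_orthogonal] at hx ⊢
  intro u hu
  rw [← ContinuousLinearMap.adjoint_inner_left,
    adjoint_apply_eq_self_of_apply_eq_self hT (mem_opKer_one_sub.1 hu)]
  exact hx u hu

theorem HarnackDominated.restrict {T T' : H →L[ℂ] H} (hdom : HarnackDominated T T')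
    {M : Submodule ℂ H} [CompleteSpace M] (hM : Set.MapsTo T M M) (hM' : Set.MapsTo T' M M) :
    HarnackDominated (T.restrict hM) (T'.restrict hM') := by
  obtain ⟨c, hc, hp⟩ := hdom
  refine ⟨c, hc, fun p hpos => (realPart_le_smul_realPart_iff _ _ _).2 fun x => ?_⟩
  rw [Submodule.coe_inner, Submodule.coe_inner, coe_aeval_restrict, coe_aeval_restrict]
  exact (realPart_le_smul_realPart_iff _ _ _).1 (hp p hpos) x

theorem HarnackDominated.opKer_le {T T' : H →L[ℂ] H} (hdom : HarnackDominated T T')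
    (hT : ‖T‖ ≤ 1) : opKer (1 - T') ≤ opKer (1 - T) := by
  obtain ⟨c, -, hp⟩ := hdom
  intro x hx
  rw [mem_opKer_one_sub] at hx ⊢
  refine apply_eq_self_of_norm_sq_le_re_inner hT ?_
  -- For p = 1 - z the right-hand side vanishes at `x`, leaving Re⟨x, x - Tx⟩ ≤ 0.
  have h := (realPart_le_smul_realPart_iff _ _ _).1 (hp (1 - X) fun z hz => by
    have := (Complex.re_le_norm z).trans hz
    simpa using this) x
  simp only [map_sub, map_one, aeval_X, sub_apply, one_apply_eq_self, hx, sub_self,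
    inner_zero_right, Complex.zero_re, mul_zero, inner_sub_right, Complex.sub_re] at h
  have h1 : (inner ℂ x x).re = ‖x‖ ^ 2 := inner_self_eq_norm_sq (𝕜 := ℂ) x
  linarith

theorem HarnackDominated.inner_sub_apply_eq_zero {T T' : H →L[ℂ] H}
    (hdom : HarnackDominated T T') (hT : ‖T‖ ≤ 1) {g : H} (hg : T g = g) (x : H) :
    inner ℂ g ((T - T') x) = 0 := by
  obtain ⟨c, hc, hle⟩ := hdom.exists_norm_sum_sq_le hT
  by_contra hne
  have hpow : ∀ (n : ℕ) (y : H), inner ℂ g ((T ^ n) y) = inner ℂ g y := fun n => by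
    induction n with
    | zero => simp
    | succ n ih =>
      intro y
      rw [pow_succ', mul_apply_eq_comp, ← ContinuousLinearMap.adjoint_inner_left,
        adjoint_apply_eq_self_of_apply_eq_self hT hg, ih]
  set a := ‖inner ℂ g ((T - T') x)‖
  have hapos : 0 < a := norm_pos_iff.2 hne
  have hbound : ∀ m : ℕ, 0 < m → m * a ^ 2 ≤ ‖g‖ ^ 2 * (c * ‖x‖ ^ 2) := by
    intro m hm
    -- Each of the `m` terms has the same inner product with `g`, so m²a² is bounded by a multiple
    -- of m.
    have h1 := hle (fun _ => 1) m x
    simp only [one_smul, norm_one, one_pow, Finset.sum_const, Finset.card_range,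
      nsmul_eq_mul, mul_one] at h1
    have h2 : m * a ≤ ‖g‖ * ‖∑ n ∈ Finset.range m, (T ^ n) ((T - T') x)‖ := by
      refine le_trans (le_of_eq ?_) (norm_inner_le_norm (𝕜 := ℂ) _ _)
      rw [inner_sum, Finset.sum_congr rfl fun n _ => hpow n _]
      rw [Finset.sum_const, Finset.card_range, nsmul_eq_mul, norm_mul, Complex.norm_natCast]
    have h3 : (m * a) ^ 2 ≤ ‖g‖ ^ 2 * (c * (m * ‖x‖ ^ 2)) :=
      (pow_le_pow_left₀ (by positivity) h2 2).trans
        (by rw [mul_pow]; exact mul_le_mul_of_nonneg_left h1 (by positivity))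
    have hm' : (0 : ℝ) < m := by exact_mod_cast hm
    refine le_of_mul_le_mul_left ?_ hm'
    linarith
  obtain ⟨m, hm⟩ := exists_nat_gt (‖g‖ ^ 2 * (c * ‖x‖ ^ 2) / a ^ 2)
  rw [div_lt_iff₀ (by positivity)] at hm
  have h0 : 0 < m := by
    rcases Nat.eq_zero_or_pos m with rfl | h
    · have : 0 ≤ ‖g‖ ^ 2 * (c * ‖x‖ ^ 2) := by positivity
      simp at hm
      linarith
    · exact h
  exact absurd (hbound m h0) (not_le.2 hm)

theorem HarnackDominated.opKer_eq {T T' : H →L[ℂ] H} (hdom : HarnackDominated T T')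
    (hT : ‖T‖ ≤ 1) (hT' : ‖T'‖ ≤ 1) : opKer (1 - T) = opKer (1 - T') := by
  refine le_antisymm (fun g hg => ?_) (hdom.opKer_le hT)
  rw [mem_opKer_one_sub] at hg ⊢
  refine apply_eq_self_of_norm_sq_le_re_inner hT' ?_
  have h := hdom.inner_sub_apply_eq_zero hT hg g
  rw [sub_apply, inner_sub_right, sub_eq_zero, hg] at h
  rw [← h]
  exact (inner_self_eq_norm_sq (𝕜 := ℂ) g).ge

theorem HarnackDominated.opClosureRange_sub_le {T T' : H →L[ℂ] H}
    (hdom : HarnackDominated T T') (hT : ‖T‖ ≤ 1) :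
    opClosureRange (T - T') ≤ opClosureRange (1 - T) := by
  rw [opClosureRange_one_sub_eq hT]
  refine Submodule.topologicalClosure_minimal _ ?_ (Submodule.isClosed_orthogonal _)
  rintro _ ⟨x, rfl⟩
  exact (Submodule.mem_orthogonal _ _).2 fun g hg =>
    hdom.inner_sub_apply_eq_zero hT (mem_opKer_one_sub.1 hg) x

theorem HarnackDominated.exists_tendsto_sum {T T' : H →L[ℂ] H}
    (hdom : HarnackDominated T T') (hT : ‖T‖ ≤ 1) {α : ℕ → ℂ}
    (hα : Summable fun n => ‖α n‖ ^ 2) (x : H) :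
    ∃ s : H, Tendsto (fun N : ℕ => ∑ n ∈ Finset.range N, α n • (T ^ n) ((T - T') x))
      atTop (𝓝 s) := by
  classical
  obtain ⟨c, hc, hle⟩ := hdom.exists_norm_sum_sq_le hT
  suffices h : Summable fun n => α n • (T ^ n) ((T - T') x) from
    ⟨_, h.hasSum.tendsto_sum_nat⟩
  have hfin : ∀ s : Finset ℕ, ‖∑ n ∈ s, α n • (T ^ n) ((T - T') x)‖ ^ 2
      ≤ c * ‖x‖ ^ 2 * ∑ n ∈ s, ‖α n‖ ^ 2 := by
    intro s
    obtain ⟨m, hm⟩ := s.exists_nat_subset_range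
    -- Cutting `α` off outside `s` extends the estimate to arbitrary finite sets, as the Cauchy
    -- criterion needs.
    have h1 := hle (fun n => if n ∈ s then α n else 0) m x
    have h2 : ∀ n, ‖if n ∈ s then α n else 0‖ ^ 2 = if n ∈ s then ‖α n‖ ^ 2 else 0 := fun n => by
      split_ifs <;> simp
    simp only [h2, ite_smul, zero_smul, Finset.sum_ite_mem,
      Finset.inter_eq_right.2 hm] at h1
    linarith
  rw [summable_iff_vanishing_norm]
  intro ε hε
  have hC : 0 < c * ‖x‖ ^ 2 + 1 := by positivity
  obtain ⟨s, hs⟩ := summable_iff_vanishing_norm.1 hα (ε ^ 2 / (c * ‖x‖ ^ 2 + 1)) (by positivity)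
  refine ⟨s, fun t ht => lt_of_pow_lt_pow_left₀ 2 hε.le ?_⟩
  have h1 := (le_abs_self _).trans_lt (hs t ht)
  rw [lt_div_iff₀ hC] at h1
  have h2 : 0 ≤ ∑ n ∈ t, ‖α n‖ ^ 2 := by positivity
  have h3 := hfin t
  linarith

end Contraction

theorem mainTheorem6 {H : Type*} [NormedAddCommGroup H] [InnerProductSpace ℂ H] [CompleteSpace H]
    (T T' : H →L[ℂ] H) (hT : ‖T‖ ≤ 1) (hT' : ‖T'‖ ≤ 1) (hdom : HarnackDominated T T') :
    (opKer (1 - T) = opKer (1 - T') ∧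
      opClosureRange (T - T') ≤ opClosureRange (1 - T) ∧
      opClosureRange (1 - T) = opClosureRange (1 - T')) ∧
    (IsOrthogonalDecomposition (opKer (1 - T)) (opClosureRange (1 - T)) ∧
      ∃ T₁ T₁' : opClosureRange (1 - T) →L[ℂ] opClosureRange (1 - T),
        IsDirectSumOp T (1 : opKer (1 - T) →L[ℂ] opKer (1 - T)) T₁ ∧
        IsDirectSumOp T' (1 : opKer (1 - T) →L[ℂ] opKer (1 - T)) T₁' ∧
        ‖T₁‖ ≤ 1 ∧ ‖T₁'‖ ≤ 1 ∧ HarnackDominated T₁ T₁') ∧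
    (∀ α : ℕ → ℂ, Summable (fun n => ‖α n‖ ^ 2) → ∀ h : H,
      ∃ s : H, Tendsto (fun N : ℕ => ∑ n ∈ Finset.range N, α n • (T ^ n) ((T - T') h))
        atTop (𝓝 s)) := by
  have hker := hdom.opKer_eq hT hT'
  have hran : opClosureRange (1 - T) = opClosureRange (1 - T') := by
    rw [opClosureRange_one_sub_eq hT, opClosureRange_one_sub_eq hT', hker]
  have hM : Set.MapsTo T (opClosureRange (1 - T)) (opClosureRange (1 - T)) :=
    fun _ hx => apply_mem_opClosureRange_one_sub hT hx
  have hM' : Set.MapsTo T' (opClosureRange (1 - T)) (opClosureRange (1 - T)) := by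
    rw [hran]
    exact fun _ hx => apply_mem_opClosureRange_one_sub hT' hx
  refine ⟨⟨hker, hdom.opClosureRange_sub_le hT, hran⟩,
    ⟨isOrthogonalDecomposition_opKer_opClosureRange hT, T.restrict hM, T'.restrict hM',
      isDirectSumOp_one_restrict hM, ?_, norm_restrict_le_one hT hM,
      norm_restrict_le_one hT' hM', hdom.restrict hM hM'⟩,
    fun α hα h => hdom.exists_tendsto_sum hT hα h⟩
  rw [hker]
  exact isDirectSumOp_one_restrict hM'
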